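/- Let $m, n$ be natural numbers with $n - m \ge 4$, and let $G$ be a real $m \times n$ standard Gaussian matrix, that is, a random matrix whose entries are independent standard normal random variables. Let $G^\dagger$ denote the Moore–Penrose pseudoinverse of $G$ and $\|\cdot\|_{\mathrm F}$ the Frobenius norm. Then for every real $t \ge 1$, $$ \mathbb{P}\left\{ \|G^\dagger\|_{\mathrm F}^2 > \frac{12\,m}{n-m}\cdot t \right\} \le 4\, t^{-(n-m)/2}. $$ -/

import Mathlib

open MeasureTheory ProbabilityTheory
open scoped Matrix Matrix.Norms.Frobenius

/-- The four Penrose conditions: `B` is a Moore–Penrose pseudoinverse of the real matrix `A`. -/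
structure IsMoorePenrose {m n : ℕ} (A : Matrix (Fin m) (Fin n) ℝ)
    (B : Matrix (Fin n) (Fin m) ℝ) : Prop where
  mul_mul_left : A * B * A = A
  mul_mul_right : B * A * B = B
  symm_left : (A * B)ᵀ = A * B
  symm_right : (B * A)ᵀ = B * A

theorem IsMoorePenrose.unique {m n : ℕ} {A : Matrix (Fin m) (Fin n) ℝ}
    {B C : Matrix (Fin n) (Fin m) ℝ} (hB : IsMoorePenrose A B) (hC : IsMoorePenrose A C) :
    B = C := by
  have h1 : A * B = A * C := by
    calc A * B = (A * B)ᵀ := hB.symm_left.symm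
      _ = ((A * C) * (A * B))ᵀ := by
          rw [← Matrix.mul_assoc (A * C) A B, hC.mul_mul_left]
      _ = (A * B) * (A * C) := by rw [Matrix.transpose_mul, hB.symm_left, hC.symm_left]
      _ = A * C := by rw [← Matrix.mul_assoc (A * B) A C, hB.mul_mul_left]
  have h2 : B * A = C * A := by
    calc B * A = (B * A)ᵀ := hB.symm_right.symm
      _ = ((B * A) * (C * A))ᵀ := by
          rw [Matrix.mul_assoc B A (C * A), ← Matrix.mul_assoc A C A, hC.mul_mul_left]
      _ = (C * A) * (B * A) := by rw [Matrix.transpose_mul, hB.symm_right, hC.symm_right]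
      _ = C * A := by
          rw [Matrix.mul_assoc C A (B * A), ← Matrix.mul_assoc A B A, hB.mul_mul_left]
  calc B = B * A * B := hB.mul_mul_right.symm
    _ = C * A * C := by rw [h2, Matrix.mul_assoc, h1, ← Matrix.mul_assoc]
    _ = C := hC.mul_mul_right

theorem exists_isMoorePenrose {m n : ℕ} (A : Matrix (Fin m) (Fin n) ℝ) :
    ∃ B : Matrix (Fin n) (Fin m) ℝ, IsMoorePenrose A B := by
  have hS : (Aᵀ * A).IsHermitian := by
    simpa [Matrix.conjTranspose_eq_transpose_of_trivial] using
      Matrix.isHermitian_conjTranspose_mul_self A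
  obtain ⟨U, d, hU, hSd⟩ : ∃ (U : Matrix (Fin n) (Fin n) ℝ) (d : Fin n → ℝ),
      Uᵀ * U = 1 ∧ Aᵀ * A = U * Matrix.diagonal d * Uᵀ := by
    refine ⟨hS.eigenvectorUnitary, hS.eigenvalues, ?_, ?_⟩
    · have := Unitary.coe_star_mul_self hS.eigenvectorUnitary
      simpa [Matrix.star_eq_conjTranspose, Matrix.conjTranspose_eq_transpose_of_trivial] using this
    · have := hS.spectral_theorem
      rw [Unitary.conjStarAlgAut_apply] at this
      simpa [Matrix.star_eq_conjTranspose, Matrix.conjTranspose_eq_transpose_of_trivial,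
        Function.comp_def] using this
  have hmul : ∀ a b : Fin n → ℝ, U * Matrix.diagonal a * Uᵀ * (U * Matrix.diagonal b * Uᵀ) =
      U * Matrix.diagonal (fun i => a i * b i) * Uᵀ := by
    intro a b
    calc U * Matrix.diagonal a * Uᵀ * (U * Matrix.diagonal b * Uᵀ)
        = U * Matrix.diagonal a * (Uᵀ * U) * Matrix.diagonal b * Uᵀ := by
          simp only [Matrix.mul_assoc]
      _ = _ := by rw [hU, Matrix.mul_one, Matrix.mul_assoc U, Matrix.diagonal_mul_diagonal]
  have hT : ∀ a : Fin n → ℝ, (U * Matrix.diagonal a * Uᵀ)ᵀ = U * Matrix.diagonal a * Uᵀ := by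
    intro a
    simp [Matrix.transpose_mul, Matrix.mul_assoc]
  obtain ⟨R, hRT, hRS, hSRS, hRSR⟩ : ∃ R : Matrix (Fin n) (Fin n) ℝ, Rᵀ = R ∧
      (R * (Aᵀ * A))ᵀ = R * (Aᵀ * A) ∧ (Aᵀ * A) * (R * (Aᵀ * A)) = Aᵀ * A ∧
      R * (Aᵀ * A) * R = R := by
    refine ⟨U * Matrix.diagonal (fun i => (d i)⁻¹) * Uᵀ, hT _, ?_, ?_, ?_⟩
    · rw [hSd, hmul, hT]
    · rw [hSd, hmul, hmul]
      simp [← mul_assoc, mul_inv_mul_cancel]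
    · rw [hSd, hmul, hmul]
      congr 3
      funext i
      by_cases h : d i = 0 <;> simp [h]
  have hA : A * (R * (Aᵀ * A)) = A := by
    have h0 : (Aᴴ * A) * (R * (Aᵀ * A) - 1) = 0 := by
      rw [Matrix.conjTranspose_eq_transpose_of_trivial, Matrix.mul_sub, hSRS, Matrix.mul_one,
        sub_self]
    rw [Matrix.conjTranspose_mul_self_mul_eq_zero, Matrix.mul_sub, Matrix.mul_one,
      sub_eq_zero] at h0
    exact h0
  refine ⟨R * Aᵀ, ?_, ?_, ?_, ?_⟩
  · simpa only [Matrix.mul_assoc] using hA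
  · calc R * Aᵀ * A * (R * Aᵀ) = R * (Aᵀ * A) * R * Aᵀ := by simp only [Matrix.mul_assoc]
      _ = R * Aᵀ := by rw [hRSR]
  · simp only [Matrix.transpose_mul, Matrix.transpose_transpose, hRT, Matrix.mul_assoc]
  · rw [Matrix.mul_assoc, hRS]

/-- The Moore–Penrose pseudoinverse of a real matrix. -/
noncomputable def pinv {m n : ℕ} (A : Matrix (Fin m) (Fin n) ℝ) : Matrix (Fin n) (Fin m) ℝ :=
  Classical.choose (exists_isMoorePenrose A)

theorem isMoorePenrose_pinv {m n : ℕ} (A : Matrix (Fin m) (Fin n) ℝ) :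
    IsMoorePenrose A (pinv A) :=
  Classical.choose_spec (exists_isMoorePenrose A)

/-- A real random matrix is standard Gaussian when its entries are independent
standard normal random variables. -/
structure IsStdGaussianMatrix {Ω : Type*} [MeasurableSpace Ω] {m n : ℕ}
    (G : Ω → Matrix (Fin m) (Fin n) ℝ) (P : Measure Ω) : Prop where
  hasLaw : ∀ i j, HasLaw (fun ω => G ω i j) (gaussianReal 0 1) P
  indep : iIndepFun (fun (p : Fin m × Fin n) ω => G ω p.1 p.2) P

/-!
# Tail bound for the Frobenius norm of the pseudoinverse of a Gaussian matrix

Let `q = (n - m) / 2`. Whatever the rank of `A`, the squared norm of the `j`-th column of `pinv A`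
is at most the inverse of the squared distance `D j` from the `j`-th row of `A` to the span of the
other rows (`ofReal_norm_pinv_sq_le`). For a Gaussian matrix the `j`-th row is independent of that
span, which has codimension at least `2 q + 1`. Hence `D j` dominates a chi-squared variable with
`2 q + 1` degrees of freedom, in the form of an inequality `E exp (-l D j) ≤ (1 + 2 l) ^ (-(q + 1/2))`
between Laplace transforms (`lintegral_exp_neg_mul_sqDistSpan_le`). Integrating this against
`l ^ (q - 1)` and using Euler's integral gives `E (D j) ^ (-q) ≤ 2 ^ (1 - q) / Γ(q)`
(`lintegral_rpow_neg_le_of_laplace`). The power mean inequality bounds the `q`-th moment of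
`∑ j, (D j)⁻¹`, and Markov's inequality for that moment gives the tail bound; the numerical
constants are absorbed by `Γ(q) ≥ q ^ (q - 1) exp (-q)` (`moment_constant_le`).

Moments are computed in `ℝ≥0∞`, where `0⁻¹ = ⊤`: rank-deficient matrices need no separate treatment.
-/

/-! ### The squared distance from a vector to the span of a family -/

/-- The squared distance from `x` to the span of the finite family `v`, written as an infimum over
coefficient vectors so that it is visibly upper semicontinuous jointly in `x` and `v`. -/
noncomputable def sqDistSpan {ι E : Type*} [Fintype ι] [NormedAddCommGroup E] [NormedSpace ℝ E]
    (x : E) (v : ι → E) : ℝ :=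
  ⨅ c : ι → ℝ, ‖x + ∑ i, c i • v i‖ ^ 2

section sqDistSpan

variable {ι E : Type*} [Fintype ι] [NormedAddCommGroup E]

theorem sqDistSpan_nonneg [NormedSpace ℝ E] (x : E) (v : ι → E) : 0 ≤ sqDistSpan x v :=
  Real.iInf_nonneg fun _ => sq_nonneg _

theorem sqDistSpan_le [NormedSpace ℝ E] (x : E) (v : ι → E) (c : ι → ℝ) :
    sqDistSpan x v ≤ ‖x + ∑ i, c i • v i‖ ^ 2 :=
  ciInf_le ⟨0, by rintro _ ⟨c, rfl⟩; positivity⟩ c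

theorem Continuous.upperSemicontinuous_sqDistSpan [NormedSpace ℝ E] {α : Type*} [TopologicalSpace α]
    {f : α → E} {g : α → ι → E} (hf : Continuous f) (hg : Continuous g) :
    UpperSemicontinuous fun a => sqDistSpan (f a) (g a) := by
  refine upperSemicontinuous_ciInf (fun a => ?_) fun c => ?_
  · exact ⟨0, by rintro _ ⟨c, rfl⟩; positivity⟩
  · exact Continuous.upperSemicontinuous (by fun_prop)

theorem measurable_sqDistSpan [NormedSpace ℝ E] [MeasurableSpace E] [BorelSpace E]
    [SecondCountableTopology E] :
    Measurable fun p : E × (ι → E) => sqDistSpan p.1 p.2 :=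
  (continuous_fst.upperSemicontinuous_sqDistSpan continuous_snd).measurable

theorem measurable_sqDistSpan_left [NormedSpace ℝ E] [MeasurableSpace E] [BorelSpace E]
    (v : ι → E) : Measurable fun x : E => sqDistSpan x v :=
  (continuous_id.upperSemicontinuous_sqDistSpan continuous_const).measurable

variable [InnerProductSpace ℝ E]

/-- There is an orthonormal basis, `Fintype.card κ` of whose vectors are orthogonal to the span of
`v`; Bessel's inequality for these vectors bounds the distance to the span from below. -/
theorem exists_orthonormalBasis_sum_sq_le_sqDistSpan [FiniteDimensional ℝ E] (v : ι → E) :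
    ∃ (k l : ℕ) (b : OrthonormalBasis (Fin k ⊕ Fin l) ℝ E),
      Module.finrank ℝ E ≤ k + Fintype.card ι ∧
      ∀ x : E, ∑ i, (b.repr x (Sum.inl i)) ^ 2 ≤ sqDistSpan x v := by
  set W := Submodule.span ℝ (Set.range v) with hW
  have hdim : Module.finrank ℝ W + Module.finrank ℝ Wᗮ = Module.finrank ℝ E :=
    W.finrank_add_finrank_orthogonal
  have hWle : Module.finrank ℝ W ≤ Fintype.card ι := finrank_range_le_card v
  set b' := stdOrthonormalBasis ℝ Wᗮ
  let u : Fin (Module.finrank ℝ Wᗮ) ⊕ Fin (Module.finrank ℝ W) → E :=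
    Sum.elim (fun i => (b' i : E)) fun _ => 0
  have hu : Orthonormal ℝ ((Set.range Sum.inl).domRestrict u) := by
    have h1 : Orthonormal ℝ fun i => (b' i : E) :=
      b'.orthonormal.comp_linearIsometry Wᗮ.subtypeₗᵢ
    constructor
    · rintro ⟨_, i, rfl⟩
      exact h1.1 i
    · rintro ⟨_, i, rfl⟩ ⟨_, j, rfl⟩ hij
      exact h1.2 fun h => hij (by simp [h])
  obtain ⟨b, hb⟩ := hu.exists_orthonormalBasis_extension_of_card_eq
    (by simp [← hdim, add_comm])
  refine ⟨_, _, b, by omega, fun x => le_ciInf fun c => ?_⟩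
  have horth : ∀ i, b.repr x (Sum.inl i) = b.repr (x + ∑ i, c i • v i) (Sum.inl i) := by
    intro i
    have hmem : ∑ i, c i • v i ∈ W :=
      Submodule.sum_mem _ fun j _ => Submodule.smul_mem _ _ (Submodule.subset_span ⟨j, rfl⟩)
    have hbi : b (Sum.inl i) = (b' i : E) := hb _ ⟨i, rfl⟩
    have h0 : inner ℝ (b (Sum.inl i)) (∑ i, c i • v i) = 0 := by
      rw [hbi]
      exact Submodule.inner_left_of_mem_orthogonal hmem (b' i).2
    rw [b.repr_apply_apply, b.repr_apply_apply, inner_add_right, h0, add_zero]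
  set y := x + ∑ i, c i • v i
  calc ∑ i, (b.repr x (Sum.inl i)) ^ 2 = ∑ i, (b.repr y (Sum.inl i)) ^ 2 := by simp_rw [horth]
    _ ≤ ∑ i, (b.repr y i) ^ 2 := by
        rw [Fintype.sum_sum_type]
        exact le_add_of_nonneg_right (Finset.sum_nonneg fun _ _ => sq_nonneg _)
    _ = ‖y‖ ^ 2 := by
        rw [← b.repr.norm_map y, EuclideanSpace.norm_sq_eq]
        simp

end sqDistSpan

/-! ### The Frobenius norm of the pseudoinverse -/

/-- For `b` the `j`-th column of the pseudoinverse, the identity `pinv A = Aᵀ (pinv A)ᵀ pinv A`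
exhibits `b / ‖b‖²` as the `j`-th row of `A` plus a combination of the other rows. Hence `‖b‖²` is
at most the inverse squared distance of that row to the span of the others; a row dependent on the
others contributes `⊤`, so no rank hypothesis is needed. -/
theorem ofReal_norm_pinv_sq_le {m n : ℕ} (A : Matrix (Fin m) (Fin n) ℝ) :
    ENNReal.ofReal (‖pinv A‖ ^ 2) ≤ ∑ j, (ENNReal.ofReal (sqDistSpan
      (WithLp.toLp 2 (A j) : EuclideanSpace ℝ (Fin n))
      (fun i : {i // i ≠ j} => WithLp.toLp 2 (A i))))⁻¹ := by
  set B := pinv A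
  have hB : IsMoorePenrose A B := isMoorePenrose_pinv A
  have hBA : B = Aᵀ * (Bᵀ * B) := by
    rw [← Matrix.mul_assoc, ← Matrix.transpose_mul, hB.symm_right, hB.mul_mul_right]
  have hnorm : ‖B‖ ^ 2 = ∑ j, ∑ l, B l j ^ 2 := by
    rw [Matrix.frobenius_norm_def, ← Real.sqrt_eq_rpow, Real.sq_sqrt (by positivity),
      Finset.sum_comm]
    simp
  rw [hnorm, ENNReal.ofReal_sum_of_nonneg fun j _ => Finset.sum_nonneg fun l _ => sq_nonneg _]
  refine Finset.sum_le_sum fun j _ => ?_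
  obtain ⟨β, hβ⟩ : ∃ β, β = ∑ l, B l j ^ 2 := ⟨_, rfl⟩
  have hβ0 : 0 ≤ β := hβ ▸ Finset.sum_nonneg fun l _ => sq_nonneg (B l j)
  rw [← hβ]
  rcases hβ0.eq_or_lt with h0 | hpos
  · simp [← h0]
  have hjj : (Bᵀ * B) j j = β := by
    simp [Matrix.mul_apply, hβ, sq]
  let c : {i // i ≠ j} → ℝ := fun i => (Bᵀ * B) i j / β
  have hcol : (WithLp.toLp 2 (A j) : EuclideanSpace ℝ (Fin n))
      + ∑ i, c i • (WithLp.toLp 2 (A i) : EuclideanSpace ℝ (Fin n))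
      = β⁻¹ • WithLp.toLp 2 fun l => B l j := by
    ext l
    have h1 : B l j = ∑ i, A i l * (Bᵀ * B) i j := by
      conv_lhs => rw [hBA]
      simp [Matrix.mul_apply]
    have h2 : ∑ i, A i l * (Bᵀ * B) i j
        = A j l * β + ∑ i : {i // i ≠ j}, A i l * (Bᵀ * B) i j := by
      rw [Fintype.sum_eq_add_sum_subtype_ne _ j, hjj]
    simp only [PiLp.add_apply, WithLp.ofLp_sum, Finset.sum_apply, PiLp.smul_apply, smul_eq_mul, c]
    rw [h1, h2, mul_add, Finset.mul_sum]
    congr 1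
    · field_simp
    · exact Finset.sum_congr rfl fun i _ => by ring
  have hle := sqDistSpan_le (WithLp.toLp 2 (A j) : EuclideanSpace ℝ (Fin n))
      (fun i : {i // i ≠ j} => WithLp.toLp 2 (A i)) c
  have hval : ‖β⁻¹ • (WithLp.toLp 2 fun l => B l j : EuclideanSpace ℝ (Fin n))‖ ^ 2 = β⁻¹ := by
    rw [norm_smul, mul_pow, EuclideanSpace.norm_sq_eq]
    simp only [Real.norm_eq_abs, sq_abs, ← hβ]
    field_simp
  rw [hcol, hval] at hle
  rw [ENNReal.le_inv_iff_le_inv, ← ENNReal.ofReal_inv_of_pos hpos]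
  exact ENNReal.ofReal_le_ofReal hle

/-! ### Negative moments from a bound on the Laplace transform -/

theorem integral_exp_neg_mul_sq_gaussianReal {l : ℝ} (hl : 0 ≤ l) :
    ∫ x, Real.exp (-(l * x ^ 2)) ∂(gaussianReal 0 1) = (1 + 2 * l) ^ (-(1 / 2) : ℝ) := by
  rw [integral_gaussianReal_eq_integral_smul one_ne_zero]
  have h : ∀ x : ℝ, gaussianPDFReal 0 1 x • Real.exp (-(l * x ^ 2))
      = (√(2 * Real.pi))⁻¹ * Real.exp (-(l + 1 / 2) * x ^ 2) := by
    intro x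
    rw [gaussianPDFReal_def, smul_eq_mul]
    simp only [NNReal.coe_one, mul_one, sub_zero]
    rw [mul_assoc, ← Real.exp_add]
    congr 2
    ring
  simp_rw [h]
  rw [integral_const_mul, integral_gaussian, ← Real.sqrt_inv, ← Real.sqrt_mul (by positivity),
    Real.rpow_neg (by positivity), ← Real.sqrt_eq_rpow, ← Real.sqrt_inv]
  congr 1
  have := Real.pi_pos
  field_simp
  ring

/-- Restrict Euler's integral for `Γ(q + 1)` to `(q, ∞)`, where `x ^ q ≥ q ^ q`. -/
theorem Real.rpow_mul_exp_neg_le_Gamma {q : ℝ} (hq : 0 < q) :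
    q ^ (q - 1) * Real.exp (-q) ≤ Real.Gamma q := by
  have h1 : q ^ q * Real.exp (-q) ≤ Real.Gamma (q + 1) := by
    rw [Real.Gamma_eq_integral (by positivity), ← integral_exp_neg_Ioi, ← integral_const_mul]
    have hint := Real.GammaIntegral_convergent (s := q + 1) (by positivity)
    have hsub : Set.Ioi q ⊆ Set.Ioi 0 := Set.Ioi_subset_Ioi hq.le
    refine le_trans (setIntegral_mono_on ?_ (hint.mono_set hsub) measurableSet_Ioi ?_)
      (setIntegral_mono_set hint ?_ hsub.eventuallyLE)
    · exact (integrableOn_exp_neg_Ioi q).const_mul _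
    · intro x hx
      rw [mul_comm, add_sub_cancel_right]
      gcongr
      exact (Set.mem_Ioi.1 hx).le
    · filter_upwards [ae_restrict_mem measurableSet_Ioi] with x hx
      have : (0 : ℝ) < x := hx
      simp only [Pi.zero_apply]
      positivity
  rw [Real.Gamma_add_one hq.ne'] at h1
  rw [Real.rpow_sub_one hq.ne', div_mul_eq_mul_div, div_le_iff₀ hq]
  linarith

theorem lintegral_Ioi_rpow_one_add_two_mul :
    ∫⁻ l in Set.Ioi (0 : ℝ), ENNReal.ofReal ((1 + 2 * l) ^ (-(3 / 2) : ℝ)) = 1 := by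
  have hderiv : ∀ x ∈ Set.Ici (0 : ℝ), HasDerivAt (fun l : ℝ => -(1 + 2 * l) ^ (-(1 / 2) : ℝ))
      ((1 + 2 * x) ^ (-(3 / 2) : ℝ)) x := by
    intro x hx
    have hx' : (0 : ℝ) ≤ x := hx
    have h1 : HasDerivAt (fun l : ℝ => 1 + 2 * l) 2 x := by
      simpa using ((hasDerivAt_id x).const_mul 2).const_add 1
    have h2 := (h1.rpow_const (p := -(1 / 2)) (Or.inl (by positivity))).neg
    convert! h2 using 1
    norm_num
  have hpos : ∀ x ∈ Set.Ioi (0 : ℝ), 0 ≤ (1 + 2 * x) ^ (-(3 / 2) : ℝ) := by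
    intro x hx
    have hx' : (0 : ℝ) < x := hx
    positivity
  have hlim : Filter.Tendsto (fun l : ℝ => -(1 + 2 * l) ^ (-(1 / 2) : ℝ)) Filter.atTop (nhds 0) := by
    have h1 : Filter.Tendsto (fun l : ℝ => 1 + 2 * l) Filter.atTop Filter.atTop :=
      Filter.tendsto_atTop_add_const_left _ _
        (Filter.Tendsto.const_mul_atTop two_pos Filter.tendsto_id)
    simpa using ((tendsto_rpow_neg_atTop (by norm_num : (0 : ℝ) < 1 / 2)).comp h1).neg
  rw [← ofReal_integral_eq_lintegral_ofReal
    (integrableOn_Ioi_deriv_of_nonneg' hderiv hpos hlim)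
    ((ae_restrict_mem measurableSet_Ioi).mono hpos),
    integral_Ioi_of_hasDerivAt_of_nonneg' hderiv hpos hlim]
  simp

/-- Comes from `l / (1 + 2 l) ≤ 1 / 2`, raised to the power `q - 1 ≥ 0`. -/
theorem rpow_mul_one_add_two_mul_rpow_le {q l : ℝ} (hq : 1 ≤ q) (hl : 0 < l) :
    l ^ (q - 1) * (1 + 2 * l) ^ (-(q + 1 / 2)) ≤ 2 ^ (1 - q) * (1 + 2 * l) ^ (-(3 / 2) : ℝ) := by
  have h1 : (1 + 2 * l) ^ (-(q + 1 / 2))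
      = (1 + 2 * l) ^ (-(q - 1)) * (1 + 2 * l) ^ (-(3 / 2) : ℝ) := by
    rw [← Real.rpow_add (by positivity)]
    congr 1
    ring
  rw [h1, ← mul_assoc]
  gcongr
  calc l ^ (q - 1) * (1 + 2 * l) ^ (-(q - 1))
      = (l / (1 + 2 * l)) ^ (q - 1) := by
        rw [Real.div_rpow hl.le (by positivity), Real.rpow_neg (by positivity), div_eq_mul_inv]
    _ ≤ (1 / 2) ^ (q - 1) := by
        refine Real.rpow_le_rpow (by positivity) ?_ (by linarith)
        rw [div_le_iff₀ (by positivity)]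
        linarith
    _ = 2 ^ (1 - q) := by
        rw [one_div, Real.inv_rpow (by positivity), ← Real.rpow_neg (by positivity)]
        congr 1
        ring

/-- Euler's integral for `y ^ (-q)`; at `y = 0` the right-hand side is infinite, in agreement with
the value `0 ^ (-q) = ⊤` in `ℝ≥0∞`. -/
theorem ofReal_Gamma_mul_rpow_neg_le {q y : ℝ} (hq : 0 < q) (hy : 0 ≤ y) :
    ENNReal.ofReal (Real.Gamma q) * ENNReal.ofReal y ^ (-q)
      ≤ ∫⁻ l in Set.Ioi (0 : ℝ), ENNReal.ofReal (l ^ (q - 1) * Real.exp (-(l * y))) := by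
  rcases hy.eq_or_lt with rfl | hy
  · have htop : ∫⁻ l in Set.Ioi (0 : ℝ), ENNReal.ofReal (l ^ (q - 1) * Real.exp (-(l * 0))) = ⊤ := by
      simp only [mul_zero, neg_zero, Real.exp_zero, mul_one]
      by_contra hne
      refine not_integrableOn_Ioi_rpow (q - 1) ((lintegral_ofReal_ne_top_iff_integrable ?_ ?_).1 hne)
      · exact (measurable_id.pow_const _).aestronglyMeasurable
      · filter_upwards [ae_restrict_mem measurableSet_Ioi] with l hl
        exact Real.rpow_nonneg (le_of_lt hl) _
    rw [htop]
    exact le_top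
  · have hval := Real.integral_rpow_mul_exp_neg_mul_Ioi hq hy
    have hG := Real.Gamma_pos_of_pos hq
    have hint : IntegrableOn (fun l : ℝ => l ^ (q - 1) * Real.exp (-(y * l))) (Set.Ioi 0) :=
      .of_integral_ne_zero (by rw [hval]; positivity)
    simp_rw [mul_comm _ y]
    rw [← ofReal_integral_eq_lintegral_ofReal hint, hval, ENNReal.ofReal_rpow_of_pos hy,
      ← ENNReal.ofReal_mul hG.le, mul_comm, one_div, Real.inv_rpow hy.le, Real.rpow_neg hy.le]
    filter_upwards [ae_restrict_mem measurableSet_Ioi] with l hl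
    have : (0 : ℝ) < l := hl
    simp only [Pi.zero_apply]
    positivity

/-- A nonnegative random variable whose Laplace transform is at most that of the chi-squared law
with `2 q + 1` degrees of freedom has a finite moment of order `-q`. -/
theorem lintegral_rpow_neg_le_of_laplace {Ω : Type*} [MeasurableSpace Ω] {μ : Measure Ω}
    [IsProbabilityMeasure μ] {Y : Ω → ℝ} (hY : Measurable Y) (hY0 : ∀ ω, 0 ≤ Y ω)
    {q : ℝ} (hq : 1 ≤ q)
    (hL : ∀ l : ℝ, 0 < l → ∫⁻ ω, ENNReal.ofReal (Real.exp (-(l * Y ω))) ∂μ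
      ≤ ENNReal.ofReal ((1 + 2 * l) ^ (-(q + 1 / 2)))) :
    ∫⁻ ω, ENNReal.ofReal (Y ω) ^ (-q) ∂μ ≤ ENNReal.ofReal (2 ^ (1 - q) / Real.Gamma q) := by
  have hG := Real.Gamma_pos_of_pos (zero_lt_one.trans_le hq)
  rw [ENNReal.ofReal_div_of_pos hG, ENNReal.le_div_iff_mul_le (by simp [hG]) (by simp), mul_comm,
    ← lintegral_const_mul' _ _ ENNReal.ofReal_ne_top]
  calc ∫⁻ ω, ENNReal.ofReal (Real.Gamma q) * ENNReal.ofReal (Y ω) ^ (-q) ∂μ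
      ≤ ∫⁻ ω, (∫⁻ l in Set.Ioi (0 : ℝ),
          ENNReal.ofReal (l ^ (q - 1) * Real.exp (-(l * Y ω)))) ∂μ :=
        lintegral_mono fun ω => ofReal_Gamma_mul_rpow_neg_le (by linarith) (hY0 ω)
    _ = ∫⁻ l in Set.Ioi (0 : ℝ), ∫⁻ ω,
          ENNReal.ofReal (l ^ (q - 1) * Real.exp (-(l * Y ω))) ∂μ := by
        refine lintegral_lintegral_swap (Measurable.aemeasurable ?_)
        unfold Function.uncurry
        fun_prop
    _ ≤ ∫⁻ l in Set.Ioi (0 : ℝ),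
          ENNReal.ofReal (2 ^ (1 - q)) * ENNReal.ofReal ((1 + 2 * l) ^ (-(3 / 2) : ℝ)) := by
        refine setLIntegral_mono' measurableSet_Ioi fun l hl => ?_
        have hl' : (0 : ℝ) < l := hl
        simp_rw [ENNReal.ofReal_mul (Real.rpow_nonneg hl'.le (q - 1))]
        rw [lintegral_const_mul' _ _ ENNReal.ofReal_ne_top, ← ENNReal.ofReal_mul (by positivity)]
        refine (mul_le_mul_right (hL l hl') _).trans ?_
        rw [← ENNReal.ofReal_mul (by positivity)]
        exact ENNReal.ofReal_le_ofReal (rpow_mul_one_add_two_mul_rpow_le hq hl')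
    _ = ENNReal.ofReal (2 ^ (1 - q)) := by
        rw [lintegral_const_mul' _ _ ENNReal.ofReal_ne_top, lintegral_Ioi_rpow_one_add_two_mul,
          mul_one]

/-! ### Distance from a Gaussian vector to an independent random subspace -/

section Gaussian

variable {ι E : Type*} [Fintype ι] [NormedAddCommGroup E] [InnerProductSpace ℝ E]
  [FiniteDimensional ℝ E] [MeasurableSpace E] [BorelSpace E]

/-- The squared distance dominates the sum of the squares of `dim E - card ι` independent standard
normal coordinates, whose Laplace transform is a product of one-dimensional Gaussian integrals. -/
theorem lintegral_exp_neg_mul_sqDistSpan_le (v : ι → E) {q l : ℝ} (hl : 0 < l)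
    (hq : 2 * q + 1 + Fintype.card ι ≤ Module.finrank ℝ E) :
    ∫⁻ x, ENNReal.ofReal (Real.exp (-(l * sqDistSpan x v))) ∂(stdGaussian E)
      ≤ ENNReal.ofReal ((1 + 2 * l) ^ (-(q + 1 / 2))) := by
  obtain ⟨k, r, b, hk, hb⟩ := exists_orthonormalBasis_sum_sq_le_sqDistSpan v
  have hk' : 2 * q + 1 ≤ k := by
    have : (Module.finrank ℝ E : ℝ) ≤ k + Fintype.card ι := by exact_mod_cast hk
    linarith
  have hmeas : Measurable fun x : E => sqDistSpan x v := measurable_sqDistSpan_left v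
  rw [stdGaussian_eq_map_pi_orthonormalBasis b, lintegral_map (by fun_prop) (by fun_prop)]
  -- Coordinates along the basis vectors that may meet the span carry the factor `1`.
  let f : Fin k ⊕ Fin r → ℝ → ℝ := Sum.elim (fun _ t => Real.exp (-(l * t ^ 2))) fun _ _ => 1
  have hf : ∀ i t, 0 ≤ f i t := by
    rintro (i | i) t
    · exact (Real.exp_pos _).le
    · exact zero_le_one
  have hle : ∀ x : Fin k ⊕ Fin r → ℝ,
      Real.exp (-(l * sqDistSpan (∑ i, x i • b i) v)) ≤ ∏ i, f i (x i) := by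
    intro x
    have hx := hb (∑ i, x i • b i)
    have hcoord : ∀ i, b.repr (∑ i, x i • b i) i = x i := by
      intro i
      rw [b.repr_apply_apply, b.orthonormal.inner_right_fintype]
    simp_rw [hcoord] at hx
    simp only [f, Fintype.prod_sum_type, Sum.elim_inl, Sum.elim_inr, Finset.prod_const_one, mul_one,
      ← Real.exp_sum, Finset.sum_neg_distrib, ← Finset.mul_sum]
    gcongr
  have hval : ∫ x : Fin k ⊕ Fin r → ℝ, ∏ i, f i (x i) ∂(Measure.pi fun _ => gaussianReal 0 1)
      = (1 + 2 * l) ^ (-(k / 2) : ℝ) := by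
    rw [integral_fintype_prod_eq_prod, Fintype.prod_sum_type]
    simp only [f, Sum.elim_inl, Sum.elim_inr, integral_exp_neg_mul_sq_gaussianReal hl.le,
      Finset.prod_const, Finset.card_univ, Fintype.card_fin, integral_const, probReal_univ,
      smul_eq_mul, mul_one, one_pow]
    rw [← Real.rpow_mul_natCast (by positivity)]
    congr 1
    ring
  have hint : Integrable (fun x : Fin k ⊕ Fin r → ℝ => ∏ i, f i (x i))
      (Measure.pi fun _ => gaussianReal 0 1) :=
    .of_integral_ne_zero (by rw [hval]; positivity)
  calc ∫⁻ x : Fin k ⊕ Fin r → ℝ, ENNReal.ofReal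
        (Real.exp (-(l * sqDistSpan (∑ i, x i • b i) v))) ∂(Measure.pi fun _ => gaussianReal 0 1)
      ≤ ∫⁻ x : Fin k ⊕ Fin r → ℝ, ENNReal.ofReal (∏ i, f i (x i))
          ∂(Measure.pi fun _ => gaussianReal 0 1) :=
        lintegral_mono fun x => ENNReal.ofReal_le_ofReal (hle x)
    _ = ENNReal.ofReal ((1 + 2 * l) ^ (-(k / 2) : ℝ)) := by
        rw [← ofReal_integral_eq_lintegral_ofReal hint
          (ae_of_all _ fun x => Finset.prod_nonneg fun i _ => hf i (x i)), hval]
    _ ≤ ENNReal.ofReal ((1 + 2 * l) ^ (-(q + 1 / 2))) := by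
        refine ENNReal.ofReal_le_ofReal (Real.rpow_le_rpow_of_exponent_le ?_ ?_) <;> linarith

/-- By independence, the spanning family may be frozen while the Gaussian vector is averaged. -/
theorem lintegral_sqDistSpan_rpow_neg_le {Ω : Type*} [MeasurableSpace Ω] {P : Measure Ω}
    [IsProbabilityMeasure P] {X : Ω → E} {V : Ω → ι → E} (hX : HasLaw X (stdGaussian E) P)
    (hV : AEMeasurable V P) (hXV : IndepFun X V P) {q : ℝ} (hq1 : 1 ≤ q)
    (hq : 2 * q + 1 + Fintype.card ι ≤ Module.finrank ℝ E) :
    ∫⁻ ω, ENNReal.ofReal (sqDistSpan (X ω) (V ω)) ^ (-q) ∂P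
      ≤ ENNReal.ofReal (2 ^ (1 - q) / Real.Gamma q) := by
  have hmeas : Measurable fun p : E × (ι → E) => ENNReal.ofReal (sqDistSpan p.1 p.2) ^ (-q) :=
    measurable_sqDistSpan.ennreal_ofReal.pow_const _
  have : IsProbabilityMeasure (P.map V) := Measure.isProbabilityMeasure_map hV
  calc ∫⁻ ω, ENNReal.ofReal (sqDistSpan (X ω) (V ω)) ^ (-q) ∂P
      = ∫⁻ p, ENNReal.ofReal (sqDistSpan p.1 p.2) ^ (-q) ∂((stdGaussian E).prod (P.map V)) := by
        rw [← hX.map_eq, ← (indepFun_iff_map_prod_eq_prod_map_map hX.aemeasurable hV).1 hXV,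
          lintegral_map' hmeas.aemeasurable (hX.aemeasurable.prodMk hV)]
    _ = ∫⁻ v, ∫⁻ x, ENNReal.ofReal (sqDistSpan x v) ^ (-q) ∂(stdGaussian E) ∂(P.map V) :=
        lintegral_prod_symm' _ hmeas
    _ ≤ ∫⁻ _, ENNReal.ofReal (2 ^ (1 - q) / Real.Gamma q) ∂(P.map V) := by
        refine lintegral_mono fun v => ?_
        exact lintegral_rpow_neg_le_of_laplace
          (measurable_sqDistSpan_left v)
          (fun x => sqDistSpan_nonneg x v) hq1
          fun l hl => lintegral_exp_neg_mul_sqDistSpan_le v hl hq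
    _ = ENNReal.ofReal (2 ^ (1 - q) / Real.Gamma q) := by simp

end Gaussian

/-! ### Rows of a Gaussian matrix -/

section Rows

variable {Ω : Type*} [MeasurableSpace Ω] {P : Measure Ω} {m n : ℕ}
  {G : Ω → Matrix (Fin m) (Fin n) ℝ}

theorem IsStdGaussianMatrix.hasLaw_row (hG : IsStdGaussianMatrix G P) (j : Fin m) :
    HasLaw (fun ω => (WithLp.toLp 2 (G ω j) : EuclideanSpace ℝ (Fin n)))
      (stdGaussian (EuclideanSpace ℝ (Fin n))) P := by
  have h1 : iIndepFun (fun (l : Fin n) ω => G ω j l) P :=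
    hG.indep.precomp (g := fun l : Fin n => (j, l)) fun _ _ h => (Prod.mk.inj h).2
  have h2 := h1.hasLaw_pi fun l => hG.hasLaw j l
  refine ⟨?_, ?_⟩
  · exact (WithLp.measurable_toLp 2 _).comp_aemeasurable h2.aemeasurable
  · rw [← map_pi_eq_stdGaussian, ← h2.map_eq, AEMeasurable.map_map_of_aemeasurable
      (WithLp.measurable_toLp 2 _).aemeasurable h2.aemeasurable]
    rfl

theorem IsStdGaussianMatrix.aemeasurable_rows (hG : IsStdGaussianMatrix G P) (j : Fin m) :
    AEMeasurable (fun ω (i : {i // i ≠ j}) =>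
      (WithLp.toLp 2 (G ω i) : EuclideanSpace ℝ (Fin n))) P :=
  aemeasurable_pi_lambda _ fun i => (hG.hasLaw_row i).aemeasurable

theorem IsStdGaussianMatrix.indepFun_row (hG : IsStdGaussianMatrix G P) (j : Fin m) :
    IndepFun (fun ω => (WithLp.toLp 2 (G ω j) : EuclideanSpace ℝ (Fin n)))
      (fun ω (i : {i // i ≠ j}) => (WithLp.toLp 2 (G ω i) : EuclideanSpace ℝ (Fin n))) P := by
  let S : Finset (Fin m × Fin n) := {p | p.1 = j}
  let T : Finset (Fin m × Fin n) := {p | p.1 ≠ j}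
  have hST : Disjoint S T := Finset.disjoint_filter_filter_not _ _ _
  have h := hG.indep.indepFun_finset₀ S T hST fun p => (hG.hasLaw p.1 p.2).aemeasurable
  let φ : (S → ℝ) → EuclideanSpace ℝ (Fin n) := fun y =>
    WithLp.toLp 2 fun l => y ⟨(j, l), by simp [S]⟩
  let ψ : (T → ℝ) → {i // i ≠ j} → EuclideanSpace ℝ (Fin n) := fun y i =>
    WithLp.toLp 2 fun l => y ⟨(i, l), by simp [T, i.2]⟩
  have hφ : Measurable φ := by fun_prop
  have hψ : Measurable ψ := by fun_prop
  exact h.comp hφ hψ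

end Rows

/-! ### The tail bound -/

/-- The bound on the moment of order `-q`, put in the form needed for Markov's inequality at level
`6 m t / q`; after inserting `Γ(q) ≥ q ^ (q - 1) exp (-q)` it reduces to `q ≤ 2 ^ q` and `e ≤ 6`. -/
theorem moment_constant_le {q : ℝ} (hq : 1 ≤ q) :
    2 ^ (1 - q) / Real.Gamma q ≤ 4 * (6 / q) ^ q := by
  have hq0 : 0 < q := by linarith
  have hG := Real.Gamma_pos_of_pos hq0
  have h1 := Real.rpow_mul_exp_neg_le_Gamma hq0
  rw [div_le_iff₀ hG]
  refine le_trans ?_ (mul_le_mul_of_nonneg_left h1 (by positivity))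
  have he : Real.exp (-q) = (Real.exp 1)⁻¹ ^ q := by
    rw [← Real.exp_neg, ← Real.exp_mul]
    congr 1
    ring
  have h2 : q ≤ 2 ^ q := by
    have := one_add_mul_self_le_rpow_one_add (s := 1) (by norm_num) hq
    norm_num at this
    linarith
  have h3 : (2 : ℝ) * 2⁻¹ ≤ 6 * (Real.exp 1)⁻¹ := by
    rw [← div_eq_mul_inv 6, le_div_iff₀ (Real.exp_pos 1)]
    linarith [Real.exp_one_lt_d9]
  have h4 : (2 : ℝ) ^ q * 2⁻¹ ^ q ≤ 6 ^ q * (Real.exp 1)⁻¹ ^ q := by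
    rw [← Real.mul_rpow (by positivity) (by positivity),
      ← Real.mul_rpow (by positivity) (by positivity)]
    gcongr
  rw [he, Real.div_rpow (by positivity) hq0.le, Real.rpow_sub_one hq0.ne',
    Real.rpow_sub two_pos, Real.rpow_one, div_eq_mul_inv 2, ← Real.inv_rpow two_pos.le]
  have hqq : 0 < q ^ q := by positivity
  have h5 : (4 : ℝ) * (6 ^ q / q ^ q) * (q ^ q / q * (Real.exp 1)⁻¹ ^ q)
      = 4 * (6 ^ q * (Real.exp 1)⁻¹ ^ q) / q := by
    field_simp
  rw [h5, le_div_iff₀ hq0]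
  have h6 : (0 : ℝ) < 2⁻¹ ^ q := by positivity
  nlinarith [mul_le_mul_of_nonneg_right h2 h6.le]

theorem theoremA7 {Ω : Type*} [MeasurableSpace Ω] (P : Measure Ω) [IsProbabilityMeasure P]
    (m n : ℕ) (hmn : m + 4 ≤ n)
    (G : Ω → Matrix (Fin m) (Fin n) ℝ) (hG : IsStdGaussianMatrix G P)
    (t : ℝ) (ht : 1 ≤ t) :
    P.real {ω | ‖pinv (G ω)‖ ^ 2 > 12 * (m : ℝ) / ((n : ℝ) - (m : ℝ)) * t}
      ≤ 4 * t ^ (-(((n : ℝ) - (m : ℝ)) / 2)) := by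
  have ht0 : 0 < t := by linarith
  obtain ⟨q, hqdef⟩ : ∃ q : ℝ, q = ((n : ℝ) - m) / 2 := ⟨_, rfl⟩
  have hq : 1 ≤ q := by
    have : (m : ℝ) + 4 ≤ n := by exact_mod_cast hmn
    linarith
  have hq0 : 0 < q := by linarith
  rw [← hqdef]
  -- For `m = 0` the threshold vanishes, so Markov's inequality is not available there.
  rcases Nat.eq_zero_or_pos m with rfl | hm
  · have h0 : ∀ A : Matrix (Fin 0) (Fin n) ℝ, ‖pinv A‖ = 0 := fun A => by
      rw [Subsingleton.elim (pinv A) 0, norm_zero]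
    simp [h0]
    positivity
  set a : ℝ := 6 * m / q * t with ha
  have hm' : (0 : ℝ) < m := by exact_mod_cast hm
  have ha0 : 0 < a := by positivity
  have haeq : 12 * (m : ℝ) / ((n : ℝ) - m) * t = a := by
    have : (n : ℝ) - m = 2 * q := by linarith
    rw [this, ha]
    field_simp
    ring
  rw [haeq]
  -- The squared distance of each row to the span of the others.
  let Z : Fin m → Ω → ENNReal := fun j ω => ENNReal.ofReal (sqDistSpan
      (WithLp.toLp 2 (G ω j) : EuclideanSpace ℝ (Fin n))
      (fun i : {i // i ≠ j} => WithLp.toLp 2 (G ω i)))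
  have hZ : ∀ j, AEMeasurable (Z j) P := fun j => by
    have h := (hG.hasLaw_row j).aemeasurable.prodMk (hG.aemeasurable_rows j)
    exact (measurable_sqDistSpan.comp_aemeasurable h).ennreal_ofReal
  have hmom : ∀ j, ∫⁻ ω, (Z j ω)⁻¹ ^ q ∂P ≤ ENNReal.ofReal (4 * (6 / q) ^ q) := by
    intro j
    simp_rw [ENNReal.inv_rpow, ← ENNReal.rpow_neg]
    refine (lintegral_sqDistSpan_rpow_neg_le (hG.hasLaw_row j) (hG.aemeasurable_rows j)
      (hG.indepFun_row j) hq ?_).trans (ENNReal.ofReal_le_ofReal (moment_constant_le hq))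
    simp [Fintype.card_subtype_compl, Nat.cast_sub (Nat.one_le_of_lt hm)]
    linarith
  have hsum : ∫⁻ ω, (∑ j, (Z j ω)⁻¹) ^ q ∂P
      ≤ ENNReal.ofReal ((m : ℝ) ^ q * (4 * (6 / q) ^ q)) := by
    calc ∫⁻ ω, (∑ j, (Z j ω)⁻¹) ^ q ∂P
        ≤ ∫⁻ ω, (m : ENNReal) ^ (q - 1) * ∑ j, (Z j ω)⁻¹ ^ q ∂P := by
          refine lintegral_mono fun ω => ?_
          simpa using ENNReal.rpow_sum_le_const_mul_sum_rpow Finset.univ (fun j => (Z j ω)⁻¹) hq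
      _ = (m : ENNReal) ^ (q - 1) * ∑ j, ∫⁻ ω, (Z j ω)⁻¹ ^ q ∂P := by
          rw [lintegral_const_mul' _ _ (by finiteness), lintegral_finsetSum' _ fun j _ => by fun_prop]
      _ ≤ (m : ENNReal) ^ (q - 1) * ∑ _j : Fin m, ENNReal.ofReal (4 * (6 / q) ^ q) := by
          gcongr with j
          exact hmom j
      _ = ENNReal.ofReal ((m : ℝ) ^ q * (4 * (6 / q) ^ q)) := by
          have hmE : (m : ENNReal) = ENNReal.ofReal m := (ENNReal.ofReal_natCast m).symm
          rw [Finset.sum_const, Finset.card_univ, Fintype.card_fin, nsmul_eq_mul, hmE,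
            ENNReal.ofReal_rpow_of_pos hm', ← mul_assoc, ← ENNReal.ofReal_mul (by positivity),
            ← ENNReal.ofReal_mul (by positivity), Real.rpow_sub_one hm'.ne',
            div_mul_cancel₀ _ hm'.ne']
  have hsub : {ω | ‖pinv (G ω)‖ ^ 2 > a}
      ⊆ {ω | ENNReal.ofReal (a ^ q) ≤ (∑ j, (Z j ω)⁻¹) ^ q} := by
    intro ω hω
    have h1 : ENNReal.ofReal a ≤ ∑ j, (Z j ω)⁻¹ :=
      (ENNReal.ofReal_le_ofReal (le_of_lt hω)).trans (ofReal_norm_pinv_sq_le (G ω))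
    rw [Set.mem_ofPred_eq, ← ENNReal.ofReal_rpow_of_pos ha0]
    exact ENNReal.rpow_le_rpow h1 hq0.le
  refine ENNReal.toReal_le_of_le_ofReal (by positivity) ?_
  calc P {ω | ‖pinv (G ω)‖ ^ 2 > a}
      ≤ P {ω | ENNReal.ofReal (a ^ q) ≤ (∑ j, (Z j ω)⁻¹) ^ q} := measure_mono hsub
    _ ≤ (∫⁻ ω, (∑ j, (Z j ω)⁻¹) ^ q ∂P) / ENNReal.ofReal (a ^ q) := by
        refine meas_ge_le_lintegral_div ?_ (by simp; positivity) ENNReal.ofReal_ne_top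
        exact (Finset.aemeasurable_fun_sum _ fun j _ => (hZ j).inv).pow_const _
    _ ≤ ENNReal.ofReal ((m : ℝ) ^ q * (4 * (6 / q) ^ q)) / ENNReal.ofReal (a ^ q) := by gcongr
    _ = ENNReal.ofReal (4 * t ^ (-q)) := by
        rw [← ENNReal.ofReal_div_of_pos (by positivity)]
        congr 1
        have h6 : a = m * (6 / q) * t := by rw [ha]; ring
        rw [h6, Real.mul_rpow (by positivity) ht0.le, Real.mul_rpow hm'.le (by positivity),
          Real.rpow_neg ht0.le]
        field_simp
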